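/- **Conventions.** Let $\mathbb F$ be a field and $k,n\ge 1$. All block-matrices have $n\times n$ blocks, and block positions are counted from $1$. Let $P(\lambda)=\sum_{i=0}^kA_i\lambda^i\in\mathbb F[\lambda]^{n\times n}$ be a matrix polynomial of grade $k$ ($A_k=0$ is allowed). For an $n\times n$ matrix $B$ define the $k\times k$ block-matrices $M_0(B)=I_{(k-1)n}\oplus B$, $M_{-k}(B)=B\oplus I_{(k-1)n}$ and $$M_i(B)=I_{(k-i-1)n}\oplus\begin{bmatrix}B&I_n\\ I_n&0\end{bmatrix}\oplus I_{(i-1)n}\qquad(1\le i\le k-1).$$ For a permutation $\mathbf q=(q_1,\dots,q_k)$ of $\{0,\dots,k-1\}$ put $M_{\mathbf q}=M_{q_1}(-A_{q_1})\cdots M_{q_k}(-A_{q_k})$ and $M_{-k}=M_{-k}(A_k)$. The Fiedler pencil is $F_{\mathbf q}(\lambda)=\lambda M_{-k}-M_{\mathbf q}$. *Index tuples.* Two tuples of nonnegative integers are equivalent if one is obtained from the other by finitely many interchanges of adjacent entries $a,b$ with $a\ne b$ and $|a-b|\neq 1$. A tuple is in column standard form if it is a concatenation $(a_s:b_s,\dots,a_1:b_1)$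 of strings $(a:b)=(a,a+1,\dots,b)$ with $b_s>\dots>b_1\ge 0$ and $0\le a_j\le b_j$. If $\mathbf t$ is equivalent to such a tuple (which is then unique), then $\mathrm{heads}(\mathbf t)=\{b_1,\dots,b_s\}$ and $\mathfrak h(\mathbf t)=|\mathrm{heads}(\mathbf t)|$. $\mathrm{rev}(\mathbf t)$ is $\mathbf t$ read backwards. $\mathbf t$ satisfies the SIP if between any two equal entries $i$ there is an entry $i+1$. *Block Kronecker pencils.* $L_s(\lambda)$ is the $s\times(s+1)$ pencil with $-1$ on the diagonal, $\lambda$ on the superdiagonal and $0$ elsewhere. For $p,q\ge 0$ a $(p,n,q,n)$-block Kronecker pencil with body $M(\lambda)$ is $$\left[\begin{array}{c|c}M(\lambda)&L_q(\lambda)^T\otimes I_n\\\hline L_p(\lambda)\otimes I_n&0\end{array}\right],$$ where $M(\lambda)=\lambda M_1+M_0$ is a pencil of $(q+1)\times(p+1)$ blocks. With $p+q+1=k$, the body satisfies the AS condition for $P$ if $$\sum_{i+j=k+2-s}[M_1]_{ij}+\sum_{i+j=k+1-s}[M_0]_{ij}=A_s\qquad(s=0,\dots,k).$$ *Block permutations.*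 For a permutation $\mathbf c=(c_1,\dots,c_k)$ of $\{1,\dots,k\}$, $\Pi_{\mathbf c}^n$ is the block-matrix with block-entries $I_n$ in positions $(c_i,i)$ and $0$ elsewhere. $H^{\mathcal B}$ is the block-transpose of $H$ (blocks are moved but not transposed). If $(\Pi^n_{\boldsymbol\ell})^{\mathcal B}F\,\Pi^n_{\mathbf r}$ is a $(p,n,q,n)$-block Kronecker pencil, the positions of the wing block-columns of $F$, and of $(\Pi^n_{\boldsymbol\ell})^{\mathcal B}F$, are $r_{p+2},\dots,r_k$; the positions of the wing block-rows of $F$, and of $F\,\Pi^n_{\mathbf r}$, are $\ell_{q+2},\dots,\ell_k$. The other block-columns and block-rows are the body ones. **Theorem.** Let $\mathbf q$ be a permutation of $\{0,\dots,k-1\}$. Then $\mathfrak h(\mathbf q),\mathfrak h(\mathrm{rev}(\mathbf q))\ge 1$, and with $p=\mathfrak h(\mathbf q)-1$ and $q=\mathfrak h(\mathrm{rev}(\mathbf q))-1$ one has $p+q+1=k$. There exist permutations $\boldsymbol\ell,\mathbf r$ of $\{1,\dots,k\}$ such that $(\Pi^n_{\boldsymbol\ell})^{\mathcal B}F_{\mathbf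 q}(\lambda)\Pi^n_{\mathbf r}$ is a $(p,n,q,n)$-block Kronecker pencil whose body $M(\lambda)$ satisfies the AS condition for $P(\lambda)$. Moreover: (a) The wing block-columns of $(\Pi^n_{\boldsymbol\ell})^{\mathcal B}F_{\mathbf q}(\lambda)$ are exactly $-e_i\otimes I_n+\lambda e_{i+1}\otimes I_n$, $1\le i\le q$. They are located exactly in the positions $k-j$ with $0\le j\le k-2$ and $j\notin\mathrm{heads}(\mathbf q)$; equivalently, with $0\le j\le k-2$ and $(\mathbf q,j)$ satisfying the SIP. (b) The wing block-rows of $F_{\mathbf q}(\lambda)\Pi^n_{\mathbf r}$ are exactly $-e_i^T\otimes I_n+\lambda e_{i+1}^T\otimes I_n$, $1\le i\le p$. They are located exactly in the positions $k-j$ with $0\le j\le k-2$ and $j\notin\mathrm{heads}(\mathrm{rev}(\mathbf q))$; equivalently, with $0\le j\le k-2$ and $(j,\mathbf q)$ satisfying the SIP. (c) $\ell_1=r_1=1$, i.e. the first block-row and the first block-column of $F_{\mathbf q}(\lambda)$ are its first body block-row and its first body block-column. The block-entry of $M(\lambda)$ in position $(1,1)$ is $\lambda A_k+A_{k-1}$.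 -/

import Mathlib

open Polynomial
open scoped Kronecker

namespace FiedlerKronecker

/-! ### Index tuples

An index tuple of nonnegative indices is a `List ℕ`. -/

/-- The Successor Infix Property: between any two equal indices `i` of the tuple there is an
index `i + 1`. -/
def SIP (t : List ℕ) : Prop :=
  ∀ a b : Fin t.length, a < b → t.get a = t.get b →
    ∃ c : Fin t.length, a < c ∧ c < b ∧ t.get c = t.get a + 1

/-- `t'` is obtained from `t` by interchanging two distinct commuting indices in adjacent
positions. -/
inductive SwapStep : List ℕ → List ℕ → Prop
  | swap (u v : List ℕ) (a b : ℕ) (hne : a ≠ b) (hab : a ≠ b + 1) (hba : b ≠ a + 1) :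
      SwapStep (u ++ a :: b :: v) (u ++ b :: a :: v)

/-- Equivalence of index tuples: finitely many (possibly zero) interchanges of adjacent distinct
commuting indices. -/
def TupleEquiv (t t' : List ℕ) : Prop := Relation.ReflTransGen SwapStep t t'

/-- The string `(a : b) = (a, a + 1, …, b)`, empty if `b < a`. -/
def string (a b : ℕ) : List ℕ := List.range' a (b + 1 - a)

/-- The data `[(a_s, b_s), …, (a_1, b_1)]` of a tuple in column standard form:
`b_s > ⋯ > b_1` and `a_j ≤ b_j`. -/
def IsColumnStandard (l : List (ℕ × ℕ)) : Prop :=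
  l.Pairwise (fun x y => y.2 < x.2) ∧ ∀ x ∈ l, x.1 ≤ x.2

/-- The tuple `(a_s : b_s, …, a_1 : b_1)`. -/
def concatStrings (l : List (ℕ × ℕ)) : List ℕ := l.flatMap (fun x => string x.1 x.2)

/-- `heads t` is the set of right end points `b_i` of the strings of the column standard form of
`t`, i.e. of the (unique) tuple in column standard form equivalent to `t`. -/
def heads (t : List ℕ) : Set ℕ :=
  {b | ∃ l : List (ℕ × ℕ), IsColumnStandard l ∧ TupleEquiv t (concatStrings l) ∧
    b ∈ l.map Prod.snd}

/-- The number `𝔥(t)` of heads of `t`. -/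
noncomputable def numHeads (t : List ℕ) : ℕ := (heads t).ncard

/-! ### Block matrices

A `k × l` block-matrix with `n × n` blocks is a matrix indexed by `Fin k × Fin n` and
`Fin l × Fin n`. All positions are counted from `0`: the `i`-th position is the index `i - 1`. -/

section Blocks

variable {R : Type*} {k l n : ℕ}

/-- The block-matrix with the given blocks. -/
def ofBlocks (f : Fin k → Fin l → Matrix (Fin n) (Fin n) R) :
    Matrix (Fin k × Fin n) (Fin l × Fin n) R :=
  Matrix.of fun x y => f x.1 y.1 x.2 y.2

/-- The block-entry in position `(i, j)`. -/
def block (H : Matrix (Fin k × Fin n) (Fin l × Fin n) R) (i : Fin k) (j : Fin l) :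
    Matrix (Fin n) (Fin n) R :=
  Matrix.of fun a b => H (i, a) (j, b)

/-- The block-transpose: the blocks are moved, but not transposed themselves. -/
def blockTranspose (H : Matrix (Fin k × Fin n) (Fin l × Fin n) R) :
    Matrix (Fin l × Fin n) (Fin k × Fin n) R :=
  ofBlocks fun i j => block H j i

/-- The block-column in position `c`. -/
def blockCol (H : Matrix (Fin k × Fin n) (Fin l × Fin n) R) (c : Fin l) :
    Matrix (Fin k × Fin n) (Fin 1 × Fin n) R :=
  H.submatrix id (fun y => (c, y.2))

/-- The block-row in position `r`. -/
def blockRow (H : Matrix (Fin k × Fin n) (Fin l × Fin n) R) (r : Fin k) :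
    Matrix (Fin 1 × Fin n) (Fin l × Fin n) R :=
  H.submatrix (fun x => (r, x.2)) id

/-- The block-permutation matrix `Π_c^n`: its block-entries `(c i, i)` are `I_n`, the others
are `0`. -/
def blockPerm (R : Type*) [Zero R] [One R] (n : ℕ) (c : Equiv.Perm (Fin k)) :
    Matrix (Fin k × Fin n) (Fin k × Fin n) R :=
  ofBlocks fun a i => if a = c i then 1 else 0

/-- The unit column vector of length `k` with the entry `1` in position `i` (from `0`). -/
def unitCol (R : Type*) [Zero R] [One R] (k i : ℕ) : Matrix (Fin k) (Fin 1) R :=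
  Matrix.of fun a _ => if (a : ℕ) = i then 1 else 0

/-- The elementary matrix `M_i(B)` for `0 ≤ i ≤ k - 1`, of `k × k` blocks. For `1 ≤ i` it is
`I_{(k-i-1)n} ⊕ [B, I; I, 0] ⊕ I_{(i-1)n}`. For `i = 0` the conditions `r + i = k` and `c + i = k`
are void, and it is `I_{(k-1)n} ⊕ B`. -/
def elementary [Zero R] [One R] (k i : ℕ) (B : Matrix (Fin n) (Fin n) R) :
    Matrix (Fin k × Fin n) (Fin k × Fin n) R :=
  ofBlocks fun r c =>
    if (r : ℕ) + i + 1 = k ∧ (c : ℕ) + i + 1 = k then B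
    else if (r : ℕ) + i + 1 = k ∧ (c : ℕ) + i = k then 1
    else if (r : ℕ) + i = k ∧ (c : ℕ) + i + 1 = k then 1
    else if (r : ℕ) + i = k ∧ (c : ℕ) + i = k then 0
    else if r = c then 1 else 0

/-- The elementary matrix `M_{-k}(B) = B ⊕ I_{(k-1)n}`. -/
def elementaryNegLast [Zero R] [One R] (k : ℕ) (B : Matrix (Fin n) (Fin n) R) :
    Matrix (Fin k × Fin n) (Fin k × Fin n) R :=
  ofBlocks fun r c => if r = c then (if (r : ℕ) = 0 then B else 1) else 0

end Blocks

section Pencils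

variable {F : Type*} [Field F] {k n : ℕ}

/-- The coefficient `A_i` of `λ^i` in a matrix polynomial. -/
def coeffMatrix {α β : Type*} (P : Matrix α β F[X]) (i : ℕ) : Matrix α β F :=
  P.map fun f => f.coeff i

/-- The matrix polynomial `P` has grade `k`: it can be written as `∑_{i=0}^k A_i λ^i`. -/
def HasGrade {α β : Type*} (P : Matrix α β F[X]) (k : ℕ) : Prop :=
  ∀ i j, (P i j).natDegree ≤ k

/-- The product `M_t^P = M_{t_1}(-A_{t_1}) ⋯ M_{t_r}(-A_{t_r})` for a tuple `t` with indices from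
`{0 : k - 1}`. -/
def elementaryProd (k : ℕ) (P : Matrix (Fin n) (Fin n) F[X]) (t : List ℕ) :
    Matrix (Fin k × Fin n) (Fin k × Fin n) F :=
  (t.map fun i => elementary k i (-(coeffMatrix P i))).prod

/-- The Fiedler pencil `F_q(λ) = λ M_{-k}^P - M_q^P`. -/
noncomputable def fiedlerPencil (k : ℕ) (P : Matrix (Fin n) (Fin n) F[X]) (q : List ℕ) :
    Matrix (Fin k × Fin n) (Fin k × Fin n) F[X] :=
  (X : F[X]) • (elementaryNegLast k (coeffMatrix P k)).map C - (elementaryProd k P q).map C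

/-- The `s × (s + 1)` pencil `L_s(λ)` with `-1` on the diagonal and `λ` on the superdiagonal. -/
noncomputable def pencilL (F : Type*) [Field F] (s : ℕ) : Matrix (Fin s) (Fin (s + 1)) F[X] :=
  Matrix.of fun i j => if (j : ℕ) = i then -1 else if (j : ℕ) = i + 1 then X else 0

/-- A partition of `k = a + b` block positions into the first `a` and the last `b` ones. -/
def splitBlocks {a b : ℕ} (n : ℕ) (h : a + b = k) :
    (Fin a × Fin n) ⊕ (Fin b × Fin n) ≃ Fin k × Fin n :=
  (Equiv.sumProdDistrib (Fin a) (Fin b) (Fin n)).symm.trans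
    ((finSumFinEquiv.trans (finCongr h)).prodCongr (Equiv.refl (Fin n)))

/-- `D` is the `(p, n, q, n)`-block Kronecker pencil
`[M, L_q(λ)ᵀ ⊗ I_n; L_p(λ) ⊗ I_n, 0]` with body the pencil `M`, as a `k × k` block-matrix,
`k = p + q + 1`. -/
def IsBlockKronecker (p q : ℕ) (h : p + q + 1 = k)
    (M : Matrix (Fin (q + 1) × Fin n) (Fin (p + 1) × Fin n) F[X])
    (D : Matrix (Fin k × Fin n) (Fin k × Fin n) F[X]) : Prop :=
  HasGrade M 1 ∧
  D = Matrix.reindex (splitBlocks n (show q + 1 + p = k by omega))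
        (splitBlocks n (show p + 1 + q = k by omega))
        (Matrix.fromBlocks M ((pencilL F q).transpose ⊗ₖ (1 : Matrix (Fin n) (Fin n) F[X]))
          (pencilL F p ⊗ₖ (1 : Matrix (Fin n) (Fin n) F[X])) 0)

/-- The antidiagonal sum `AS(M, s)` of a pencil `M(λ) = λ M_1 + M_0` of `(q + 1) × (p + 1)` blocks.
With `k = p + q + 1` and positions counted from `1` it is
`∑_{i+j=k+2-s} [M_1]_{ij} + ∑_{i+j=k+1-s} [M_0]_{ij}`. -/
def antidiagonalSum {p q : ℕ} (M : Matrix (Fin (q + 1) × Fin n) (Fin (p + 1) × Fin n) F[X])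
    (s : ℕ) : Matrix (Fin n) (Fin n) F :=
  (∑ i : Fin (q + 1), ∑ j : Fin (p + 1),
      if (i : ℕ) + j + s = p + q + 1 then block (coeffMatrix M 1) i j else 0) +
  (∑ i : Fin (q + 1), ∑ j : Fin (p + 1),
      if (i : ℕ) + j + s = p + q then block (coeffMatrix M 0) i j else 0)

/-- The AS condition for a matrix polynomial `P` of grade `p + q + 1`. -/
def SatisfiesAS {p q : ℕ} (M : Matrix (Fin (q + 1) × Fin n) (Fin (p + 1) × Fin n) F[X])
    (P : Matrix (Fin n) (Fin n) F[X]) : Prop :=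
  ∀ s ≤ p + q + 1, antidiagonalSum M s = coeffMatrix P s

/-- The positions of the wing block-columns relative to `(ℓ, r, p, q)`: those that the column
permutation `r` does not move to the first `p + 1` positions. -/
def wingCols (r : Equiv.Perm (Fin k)) (p : ℕ) : Set (Fin k) :=
  {c | ∃ i : Fin k, p + 1 ≤ (i : ℕ) ∧ r i = c}

/-- The positions of the wing block-rows relative to `(ℓ, r, p, q)`: those that the row
permutation `ℓ` does not move to the first `q + 1` positions. -/
def wingRows (l : Equiv.Perm (Fin k)) (q : ℕ) : Set (Fin k) :=
  {c | ∃ i : Fin k, q + 1 ≤ (i : ℕ) ∧ l i = c}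

/-- The block-column `-e_i ⊗ I_n + λ e_{i+1} ⊗ I_n` (`e_i` with `i` counted from `0`). -/
noncomputable def wingColForm (F : Type*) [Field F] (k n i : ℕ) :
    Matrix (Fin k × Fin n) (Fin 1 × Fin n) F[X] :=
  -(unitCol F[X] k i ⊗ₖ (1 : Matrix (Fin n) (Fin n) F[X])) +
    (X : F[X]) • (unitCol F[X] k (i + 1) ⊗ₖ (1 : Matrix (Fin n) (Fin n) F[X]))

/-- The block-row `-e_iᵀ ⊗ I_n + λ e_{i+1}ᵀ ⊗ I_n` (`e_i` with `i` counted from `0`). -/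
noncomputable def wingRowForm (F : Type*) [Field F] (k n i : ℕ) :
    Matrix (Fin 1 × Fin n) (Fin k × Fin n) F[X] :=
  -((unitCol F[X] k i).transpose ⊗ₖ (1 : Matrix (Fin n) (Fin n) F[X])) +
    (X : F[X]) • ((unitCol F[X] k (i + 1)).transpose ⊗ₖ (1 : Matrix (Fin n) (Fin n) F[X]))

end Pencils

end FiedlerKronecker

open FiedlerKronecker

namespace FiedlerKronecker

/-! Elementary matrices with nonadjacent indices commute, so `M_q` depends only on which of `j` and
`j + 1` comes first in `q`, that is, on `Prec q`. The largest index fails to commute with only one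
other index and can therefore be moved to an end of the tuple (`exists_tupleEquiv_largest`). With
`N` the product for the shorter tuple, the product of size `k + 1` is `1 ⊕ N` times `M_k(-A_k)`, on
the right if `k - 1` precedes `k` and on the left otherwise. Over the ring of `n × n` blocks this is
the recursion `fiedlerCoeff` (`prod_elementaryBlocks_apply`).

Counting from 1, multiplication on the right keeps the first column of `N`, with `-A_k` put on top
of it, inserts `e_1` as second column, and shifts the other columns right and down. Together with
the diagonal of `λ M_{-k}`, the inserted column becomes `-e_1 + λ e_2`, a new first wing column. The
old wing columns `-e_i + λ e_{i+1}` become `-e_{i+1} + λ e_{i+2}`, and the new first row is a body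
row. In the antidiagonal sums the old leading block `λ A_k` is replaced by the constant block `A_k`,
and `λ A_{k+1}` enters at the corner. Multiplication on the left gives the block-transposed picture.
`IsKroneckerOrder` is the invariant of this induction, and `IsKroneckerOrder.extend` is its step.

Thus each `j ≤ k - 2` yields a wing column at position `k - j` if `Prec q j`, and a wing row there
otherwise. The combinatorial descriptions are read off from `Prec`: apart from the largest index,
the heads are the `j` without `Prec q j` (`mem_heads_iff`), `(q, j)` satisfies the SIP exactly when
`Prec q j`, and reversal negates `Prec`. -/

/-! ### Order of consecutive indices in a tuple -/

/-- The index `j` occurs once, `j + 1` occurs once, and `j` precedes `j + 1` in the tuple. -/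
def Prec (t : List ℕ) (j : ℕ) : Prop := t.filter (fun x => x = j ∨ x = j + 1) = [j, j + 1]

theorem SwapStep.perm {t t' : List ℕ} (h : SwapStep t t') : t.Perm t' := by
  obtain ⟨u, v, a, b, -, -, -⟩ := h
  exact List.Perm.append_left u (List.Perm.swap b a v)

theorem TupleEquiv.perm {t t' : List ℕ} (h : TupleEquiv t t') : t.Perm t' := by
  induction h with
  | refl => exact List.Perm.refl _
  | tail _ h ih => exact ih.trans h.perm

theorem SwapStep.filter_eq {t t' : List ℕ} (h : SwapStep t t') (j : ℕ) :
    t.filter (fun x => x = j ∨ x = j + 1) = t'.filter (fun x => x = j ∨ x = j + 1) := by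
  obtain ⟨u, v, a, b, hne, hab, hba⟩ := h
  simp only [List.filter_append, List.filter_cons]
  congr 1
  split_ifs with h1 h2 h2 <;> try rfl
  simp only [decide_eq_true_eq] at h1 h2
  omega

theorem TupleEquiv.prec_iff {t t' : List ℕ} (h : TupleEquiv t t') (j : ℕ) :
    Prec t j ↔ Prec t' j := by
  induction h with
  | refl => rfl
  | tail _ h ih => rw [ih, Prec, Prec, h.filter_eq]

theorem TupleEquiv.append_left {t t' : List ℕ} (h : TupleEquiv t t') (w : List ℕ) :
    TupleEquiv (w ++ t) (w ++ t') := by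
  refine Relation.ReflTransGen.trans_induction_on h (fun _ => .refl) ?_ fun _ _ h1 h2 => h1.trans h2
  rintro _ _ ⟨u, v, a, b, h1, h2, h3⟩
  exact .single (by simpa using SwapStep.swap (w ++ u) v a b h1 h2 h3)

theorem TupleEquiv.append_right {t t' : List ℕ} (h : TupleEquiv t t') (w : List ℕ) :
    TupleEquiv (t ++ w) (t' ++ w) := by
  refine Relation.ReflTransGen.trans_induction_on h (fun _ => .refl) ?_ fun _ _ h1 h2 => h1.trans h2
  rintro _ _ ⟨u, v, a, b, h1, h2, h3⟩
  exact .single (by simpa using SwapStep.swap u (v ++ w) a b h1 h2 h3)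

theorem tupleEquiv_symm {t t' : List ℕ} (h : TupleEquiv t t') : TupleEquiv t' t := by
  refine Relation.ReflTransGen.trans_induction_on h (fun _ => .refl) ?_ fun _ _ h1 h2 => h2.trans h1
  rintro _ _ ⟨u, v, a, b, h1, h2, h3⟩
  exact .single (SwapStep.swap u v b a h1.symm h3 h2)

theorem tupleEquiv_cons_append (a : ℕ) (v : List ℕ)
    (h : ∀ b ∈ v, a ≠ b ∧ a ≠ b + 1 ∧ b ≠ a + 1) : TupleEquiv (a :: v) (v ++ [a]) := by
  induction v with
  | nil => exact Relation.ReflTransGen.refl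
  | cons b v ih =>
    obtain ⟨h1, h2, h3⟩ := h b (by simp)
    refine Relation.ReflTransGen.head (SwapStep.swap [] v a b h1 h2 h3) ?_
    exact (ih fun x hx => h x (by simp [hx])).append_left [b]

theorem filter_eq_or {k : ℕ} {t : List ℕ} (ht : t.Perm (List.range k)) {j : ℕ} (hj : j + 2 ≤ k) :
    t.filter (fun x => x = j ∨ x = j + 1) = [j, j + 1] ∨
      t.filter (fun x => x = j ∨ x = j + 1) = [j + 1, j] := by
  have h : ∀ m, ((List.range (j + 2 + m)).filter (fun x => x = j ∨ x = j + 1)) = [j, j + 1] := by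
    intro m
    rw [List.range_add, List.range_succ, List.range_succ]
    simp only [List.filter_append]
    have h1 : (List.range j).filter (fun x => x = j ∨ x = j + 1) = [] := by
      simp only [List.filter_eq_nil_iff, List.mem_range, decide_eq_true_eq]
      omega
    have h2 : ((List.range m).map (j + 2 + ·)).filter (fun x => x = j ∨ x = j + 1) = [] := by
      simp only [List.filter_eq_nil_iff, List.mem_map, List.mem_range, decide_eq_true_eq]
      rintro x ⟨y, -, rfl⟩
      omega
    rw [h1, h2]
    simp
  have h2 := ht.filter (fun x => x = j ∨ x = j + 1)
  obtain ⟨m, rfl⟩ := Nat.exists_eq_add_of_le hj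
  rw [h m] at h2
  have h3 : t.filter (fun x => x = j ∨ x = j + 1) ∈ [j, j + 1].permutations :=
    List.mem_permutations.2 h2
  simpa [List.permutations, List.permutationsAux, List.permutationsAux.rec,
    List.permutationsAux2] using h3

theorem prec_reverse {k : ℕ} {t : List ℕ} (ht : t.Perm (List.range k)) {j : ℕ} (hj : j + 2 ≤ k) :
    Prec t.reverse j ↔ ¬ Prec t j := by
  unfold Prec
  rw [List.filter_reverse]
  rcases filter_eq_or ht hj with h | h <;> rw [h] <;> simp

theorem prec_append_cons {k : ℕ} {u v : List ℕ} {j : ℕ}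
    (ht : (u ++ j :: v).Perm (List.range k)) (hj : j + 2 ≤ k) :
    Prec (u ++ j :: v) j ↔ j + 1 ∈ v := by
  have hnd : (u ++ j :: v).Nodup := ht.nodup_iff.2 List.nodup_range
  have hmem : j + 1 ∈ u ++ j :: v := ht.mem_iff.2 (by simp; omega)
  have key : j + 1 ∉ u → Prec (u ++ j :: v) j := by
    intro hu
    have h1 : u.filter (fun x => x = j ∨ x = j + 1) = [] := by
      simp only [List.filter_eq_nil_iff, decide_eq_true_eq]
      rintro x hx (rfl | rfl)
      · simp [List.nodup_append] at hnd
        grind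
      · exact hu hx
    rcases filter_eq_or ht hj with h | h
    · exact h
    · rw [List.filter_append, h1] at h
      simp at h
  constructor
  · intro h
    by_contra hv
    unfold Prec at h
    have hu : j + 1 ∈ u := by
      simp at hmem
      tauto
    have h2 : j + 1 ∈ u.filter (fun x => x = j ∨ x = j + 1) := by simp [hu]
    rw [List.filter_append] at h
    have h3 : u.filter (fun x => x = j ∨ x = j + 1) = [j + 1] := by
      have h4 : (j :: v).filter (fun x => x = j ∨ x = j + 1) = [j] := by
        simp only [List.filter_cons, true_or, decide_true, if_true]
        congr 1
        simp only [List.filter_eq_nil_iff, decide_eq_true_eq]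
        rintro x hx (rfl | rfl)
        · simp [List.nodup_append] at hnd
          grind
        · exact hv hx
      -- Comparing lengths leaves room for a single entry in the filtered `u`, which must be `j +
      -- 1`; then `j + 1` precedes `j`, against `h`.
      have := congrArg List.length h
      rw [h4] at this h
      match hw : u.filter (fun x => x = j ∨ x = j + 1) with
      | [] => rw [hw] at h2; simp at h2
      | [x] => rw [hw] at h2; simp at h2; rw [h2]
      | _ :: _ :: _ => rw [hw] at this; simp at this
    rw [h3] at h
    simp at h
  · intro hv
    apply key
    intro hu
    rw [List.nodup_append] at hnd
    exact hnd.2.2 _ hu _ (by simp [hv]) rfl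

theorem prec_append_cons_succ {k : ℕ} {u v : List ℕ} {j : ℕ}
    (ht : (u ++ (j + 1) :: v).Perm (List.range k)) (hj : j + 2 ≤ k) :
    Prec (u ++ (j + 1) :: v) j ↔ j ∈ u := by
  have hnd : (u ++ (j + 1) :: v).Nodup := ht.nodup_iff.2 List.nodup_range
  have hmem : j ∈ u ++ (j + 1) :: v := ht.mem_iff.2 (by simp; omega)
  rw [List.nodup_append] at hnd
  constructor
  · intro h
    by_contra hu
    have hv : j ∈ v := by simpa [hu] using hmem
    obtain ⟨v1, v2, rfl⟩ := List.append_of_mem hv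
    have h2 : u ++ (j + 1) :: (v1 ++ j :: v2) = (u ++ (j + 1) :: v1) ++ j :: v2 := by simp
    rw [h2] at h ht
    have h3 := (prec_append_cons ht hj).1 h
    have := hnd.2.1
    simp [h3] at this
  · intro hu
    obtain ⟨u1, u2, rfl⟩ := List.append_of_mem hu
    have h2 : (u1 ++ j :: u2) ++ (j + 1) :: v = u1 ++ j :: (u2 ++ (j + 1) :: v) := by simp
    rw [h2] at ht ⊢
    exact (prec_append_cons ht hj).2 (by simp)

/-- Only `m` blocks the way of `m + 1`. If `m` lies to its left, `m + 1` can travel to the right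
end, otherwise to the left end; the order of the remaining indices is untouched. -/
theorem exists_tupleEquiv_largest {m : ℕ} {t : List ℕ} (ht : t.Perm (List.range (m + 2))) :
    ∃ t' : List ℕ, t'.Perm (List.range (m + 1)) ∧ (∀ j < m, Prec t' j ↔ Prec t j) ∧
      ((Prec t m ∧ TupleEquiv t (t' ++ [m + 1])) ∨ (¬ Prec t m ∧ TupleEquiv t ((m + 1) :: t'))) := by
  have hmem : m + 1 ∈ t := ht.mem_iff.2 (by simp)
  have hnd : t.Nodup := ht.nodup_iff.2 List.nodup_range
  obtain ⟨u, v, rfl⟩ := List.append_of_mem hmem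
  have hlt : ∀ x ∈ u ++ (m + 1) :: v, x < m + 2 := fun x hx => by simpa using ht.mem_iff.1 hx
  have hperm : (u ++ v).Perm (List.range (m + 1)) := by
    rw [List.range_succ] at ht
    have h1 := (List.perm_middle.symm.trans ht).trans List.perm_append_comm
    exact List.Perm.cons_inv h1
  refine ⟨u ++ v, hperm, ?_, ?_⟩
  · intro j hj
    have h1 : ¬ m + 1 = j := by omega
    have h2 : ¬ m = j := by omega
    simp [Prec, List.filter_append, h1, h2]
  have hiff := prec_append_cons_succ ht le_rfl
  rw [List.nodup_append] at hnd
  obtain ⟨hu, hv, huv⟩ := hnd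
  by_cases h : Prec (u ++ (m + 1) :: v) m
  · refine Or.inl ⟨h, ?_⟩
    have hmu := hiff.1 h
    rw [List.append_assoc]
    refine (tupleEquiv_cons_append _ _ ?_).append_left u
    intro b hb
    have h1 := hlt b (by simp [hb])
    have h2 : b ≠ m := fun e => huv _ hmu _ (by simp [e ▸ hb]) rfl
    have h3 : b ≠ m + 1 := fun e => by subst e; simp [hb] at hv
    omega
  · refine Or.inr ⟨h, ?_⟩
    have hmu := fun e => h (hiff.2 e)
    have : TupleEquiv (u ++ [m + 1]) ((m + 1) :: u) := by
      refine tupleEquiv_symm (tupleEquiv_cons_append _ _ ?_)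
      intro b hb
      have h1 := hlt b (by simp [hb])
      have h2 : b ≠ m := fun e => hmu (e ▸ hb)
      have h3 : b ≠ m + 1 := fun e => huv _ hb _ (by simp) e
      omega
    simpa using this.append_right v

/-! ### Heads -/

theorem string_succ {a b : ℕ} (h : a ≤ b) : string a (b + 1) = string a b ++ [b + 1] := by
  unfold string
  rw [show b + 1 + 1 - a = (b + 1 - a) + 1 by omega, List.range'_concat]
  congr 2
  omega

theorem mem_string {a b x : ℕ} : x ∈ string a b ↔ a ≤ x ∧ x ≤ b := by
  simp only [string, List.mem_range'_1]
  omega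

theorem string_append {a b x : ℕ} (h1 : a ≤ x) (h2 : x < b) :
    ∃ u v, string a b = u ++ x :: (x + 1) :: v := by
  refine ⟨List.range' a (x - a), List.range' (x + 2) (b - x - 1), ?_⟩
  unfold string
  rw [show b + 1 - a = (x - a) + ((b - x - 1) + 1 + 1) by omega, ← List.range'_append_1,
    List.range'_succ, List.range'_succ]
  congr 2
  · omega
  · congr 1
    · omega
    · congr 1
      omega

/-- The leading string is required to end at `m` so that the induction runs: the later strings stay
below `m`, hence commute with `m + 1`. This index then either prolongs the leading string or forms a
new string in front. -/
theorem exists_columnStandard (m : ℕ) : ∀ t : List ℕ, t.Perm (List.range (m + 1)) →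
    ∃ a l, IsColumnStandard ((a, m) :: l) ∧ TupleEquiv t (concatStrings ((a, m) :: l)) := by
  induction m with
  | zero =>
    intro t ht
    refine ⟨0, [], by simp [IsColumnStandard], ?_⟩
    rw [List.perm_singleton.1 (show t.Perm [0] from ht)]
    exact Relation.ReflTransGen.refl
  | succ m ih =>
    intro t ht
    obtain ⟨t', ht', -, h⟩ := exists_tupleEquiv_largest ht
    obtain ⟨a, l, hl, hequiv⟩ := ih t' ht'
    have hlt : ∀ x ∈ l, x.2 < m := (List.pairwise_cons.1 hl.1).1
    have hle := (hl.2 (a, m) (by simp))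
    rcases h with ⟨-, h⟩ | ⟨-, h⟩
    · refine ⟨a, l, ⟨?_, ?_⟩, ?_⟩
      · refine List.pairwise_cons.2 ⟨fun x hx => ?_, (List.pairwise_cons.1 hl.1).2⟩
        have := hlt x hx
        simp only
        omega
      · intro x hx
        rcases List.mem_cons.1 hx with rfl | hx
        · simp only at hle ⊢
          omega
        · exact hl.2 x (by simp [hx])
      · refine Relation.ReflTransGen.trans h
          (Relation.ReflTransGen.trans (hequiv.append_right [m + 1]) ?_)
        simp only [concatStrings, List.flatMap_cons, string_succ hle, List.append_assoc]
        refine TupleEquiv.append_left (tupleEquiv_symm (tupleEquiv_cons_append _ _ ?_)) _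
        intro b hb
        obtain ⟨x, hx, hb⟩ := List.mem_flatMap.1 hb
        have := mem_string.1 hb
        have := hlt x hx
        omega
    · refine ⟨m + 1, (a, m) :: l, ⟨?_, ?_⟩, ?_⟩
      · refine List.pairwise_cons.2 ⟨fun x hx => ?_, hl.1⟩
        rcases List.mem_cons.1 hx with rfl | hx
        · simp
        · have := hlt x hx
          simp only
          omega
      · intro x hx
        rcases List.mem_cons.1 hx with rfl | hx
        · simp
        · exact hl.2 x hx
      · refine Relation.ReflTransGen.trans h ?_
        have : concatStrings ((m + 1, m + 1) :: (a, m) :: l) =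
            [m + 1] ++ concatStrings ((a, m) :: l) := by
          simp [concatStrings, string]
        rw [this]
        exact hequiv.append_left [m + 1]

/-- Inside a string, `b` is followed by `b + 1`. After the string ending at `b`, all later strings
have smaller heads, so `b + 1` cannot come later. -/
theorem mem_snd_iff {k : ℕ} {l : List (ℕ × ℕ)} (hl : IsColumnStandard l)
    (hp : (concatStrings l).Perm (List.range k)) (b : ℕ) :
    b ∈ l.map Prod.snd ↔ b < k ∧ (b + 2 ≤ k → ¬ Prec (concatStrings l) b) := by
  constructor
  · intro hb
    obtain ⟨⟨a, b'⟩, hx, rfl⟩ := List.mem_map.1 hb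
    simp only
    obtain ⟨l1, l2, rfl⟩ := List.append_of_mem hx
    have hab : a ≤ b' := hl.2 _ hx
    have hbk : b' < k := List.mem_range.1 (hp.mem_iff.1
      (List.mem_flatMap.2 ⟨_, hx, mem_string.2 ⟨hab, le_rfl⟩⟩))
    refine ⟨hbk, fun hbk' h => ?_⟩
    have hs : string a b' = List.range' a (b' - a) ++ [b'] := by
      unfold string
      rw [show b' + 1 - a = (b' - a) + 1 by omega, List.range'_concat]
      congr 2
      omega
    have he : concatStrings (l1 ++ (a, b') :: l2) =
        (concatStrings l1 ++ List.range' a (b' - a)) ++ b' :: concatStrings l2 := by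
      simp [concatStrings, hs]
    rw [he] at h hp
    have h1 := (prec_append_cons hp hbk').1 h
    obtain ⟨y, hy, h2⟩ := List.mem_flatMap.1 h1
    have h3 := mem_string.1 h2
    have h4 := (List.pairwise_cons.1 (List.pairwise_append.1 hl.1).2.1).1 y hy
    simp only at h4
    omega
  · rintro ⟨hb, h⟩
    by_contra hn
    obtain ⟨⟨a, b'⟩, hx, hbx⟩ := List.mem_flatMap.1 (hp.mem_iff.2 (List.mem_range.2 hb))
    have h1 := mem_string.1 hbx
    simp only at h1
    have h2 : b ≠ b' := fun e => hn (List.mem_map.2 ⟨_, hx, e.symm⟩)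
    have hb' : b' < k := List.mem_range.1 (hp.mem_iff.1
      (List.mem_flatMap.2 ⟨_, hx, mem_string.2 ⟨hl.2 _ hx, le_rfl⟩⟩))
    refine h (by omega) ?_
    obtain ⟨u, v, huv⟩ := string_append h1.1 (show b < b' by omega)
    obtain ⟨l1, l2, rfl⟩ := List.append_of_mem hx
    have he : concatStrings (l1 ++ (a, b') :: l2) =
        (concatStrings l1 ++ u) ++ b :: ((b + 1) :: v ++ concatStrings l2) := by
      simp [concatStrings, huv]
    rw [he] at hp ⊢
    exact (prec_append_cons hp (by omega)).2 (by simp)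

/-- `Prec` is invariant under equivalence, so every column standard form of `t` gives the same
answer and its uniqueness need not be proved. -/
theorem mem_heads_iff {k : ℕ} {t : List ℕ} (ht : t.Perm (List.range k)) (hk : 0 < k) (b : ℕ) :
    b ∈ heads t ↔ b < k ∧ (b + 2 ≤ k → ¬ Prec t b) := by
  constructor
  · rintro ⟨l, hl, he, hb⟩
    rw [mem_snd_iff hl (he.perm.symm.trans ht)] at hb
    rwa [he.prec_iff]
  · intro hb
    obtain ⟨m, rfl⟩ : ∃ m, k = m + 1 := ⟨k - 1, by omega⟩
    obtain ⟨a, l, hl, he⟩ := exists_columnStandard m t ht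
    refine ⟨_, hl, he, ?_⟩
    rw [mem_snd_iff hl (he.perm.symm.trans ht)]
    rwa [he.prec_iff] at hb

/-- The summand 1 is the largest index `m`, which is always a head. The decidability instance is
left arbitrary so as to match the classical one in `IsKroneckerOrder`. -/
theorem numHeads_eq {m : ℕ} {t : List ℕ} (ht : t.Perm (List.range (m + 1))) (c : ℕ → Prop)
    {_ : DecidablePred c} (hc : ∀ j < m, c j ↔ ¬ Prec t j) : numHeads t = Nat.count c m + 1 := by
  have h : heads t = ↑(insert m ((Finset.range m).filter c)) := by
    ext b
    rw [mem_heads_iff ht (Nat.succ_pos m)]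
    simp only [Finset.coe_insert, Finset.coe_filter, Finset.mem_range, Set.mem_insert_iff,
      Set.mem_ofPred_eq]
    constructor
    · rintro ⟨h1, h2⟩
      by_cases hb : b = m
      · exact Or.inl hb
      · exact Or.inr ⟨by omega, (hc b (by omega)).2 (h2 (by omega))⟩
    · rintro (rfl | ⟨h1, h2⟩)
      · exact ⟨by omega, fun h => by omega⟩
      · exact ⟨by omega, fun _ => (hc b h1).1 h2⟩
  rw [numHeads, h, Set.ncard_coe_finset, Finset.card_insert_of_notMem (by simp),
    Nat.count_eq_card_filter_range]

/-! ### The Successor Infix Property -/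

theorem sip_iff (t : List ℕ) :
    SIP t ↔ ∀ u v w i, t = u ++ i :: (v ++ i :: w) → i + 1 ∈ v := by
  constructor
  · rintro h u v w i rfl
    obtain ⟨⟨c, hc⟩, h1, h2, h3⟩ := h ⟨u.length, by simp⟩ ⟨u.length + 1 + v.length, by simp; omega⟩
      (by simp [Fin.lt_def]; omega) (by
        simp only [List.get_eq_getElem]
        rw [List.getElem_append_right (by omega), List.getElem_append_right (by omega)]
        simp [add_assoc, add_comm 1])
    simp only [Fin.lt_def] at h1 h2
    simp only [List.get_eq_getElem] at h3
    obtain ⟨d, rfl⟩ : ∃ d, c = u.length + (d + 1) := ⟨c - u.length - 1, by omega⟩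
    have hd : d < v.length := by omega
    rw [List.getElem_append_right (by omega)] at h3
    simp [List.getElem_append_left, hd] at h3
    exact h3 ▸ List.getElem_mem hd
  · rintro h ⟨a, ha⟩ ⟨b, hb⟩ hab he
    simp only [List.get_eq_getElem, Fin.lt_def] at he hab ⊢
    have h1 : t = t.take a ++ t[a] :: ((t.drop (a + 1)).take (b - (a + 1)) ++ t[a] ::
        t.drop (b + 1)) := by
      conv_lhs => rw [← List.take_append_drop a t, List.drop_eq_getElem_cons ha,
        ← List.take_append_drop (b - (a + 1)) (t.drop (a + 1)), List.drop_drop,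
        show a + 1 + (b - (a + 1)) = b by omega, List.drop_eq_getElem_cons hb, ← he]
    have h2 := h _ _ _ _ h1
    obtain ⟨d, hd, h3⟩ := List.getElem_of_mem h2
    simp only [List.length_take, List.length_drop] at hd
    refine ⟨⟨a + 1 + d, by omega⟩, by simp only; omega, by simp only; omega, ?_⟩
    simpa using h3

theorem sip_reverse (t : List ℕ) : SIP t.reverse ↔ SIP t := by
  have key : ∀ t : List ℕ, SIP t → SIP t.reverse := by
    intro t h
    rw [sip_iff] at h ⊢
    intro u v w i he
    have := h w.reverse v.reverse u.reverse i (by rw [← List.reverse_reverse t, he]; simp)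
    simpa using this
  exact ⟨fun h => by simpa using key _ h, key t⟩

/-- As `t` has no repetitions, the only pair of equal entries in `t ++ [j]` consists of the old `j`
and the final one; the SIP then asks for `j + 1` after the old `j`. -/
theorem sip_append_singleton_iff {k : ℕ} {t : List ℕ} (ht : t.Perm (List.range k)) {j : ℕ}
    (hj : j + 2 ≤ k) : SIP (t ++ [j]) ↔ Prec t j := by
  have hnd : t.Nodup := ht.nodup_iff.2 List.nodup_range
  obtain ⟨u, v, rfl⟩ := List.append_of_mem (ht.mem_iff.2 (List.mem_range.2 (show j < k by omega)))
  rw [prec_append_cons ht hj, sip_iff]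
  constructor
  · intro h
    exact h u v [] j (by simp)
  · intro h u' v' w i he
    -- If `w` is empty, the second `i` is the appended entry. Otherwise both copies of `i` lie in
    -- `t`, which is impossible.
    rcases List.eq_nil_or_concat w with rfl | ⟨w, x, rfl⟩
    · have he' : u ++ j :: v ++ [j] = (u' ++ i :: v') ++ [i] := by simpa using he
      obtain ⟨h1, h2⟩ := List.append_inj' he' rfl
      obtain rfl : j = i := by simpa using h2
      have h3 : u = u' ∧ v = v' := by
        rw [List.nodup_append] at hnd
        obtain ⟨-, hv, huv⟩ := hnd
        have hju : j ∉ u := fun hu => huv _ hu _ (by simp) rfl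
        have hjv : j ∉ v := (List.nodup_cons.1 hv).1
        rcases List.append_eq_append_iff.1 h1 with ⟨a, ha, hb⟩ | ⟨a, ha, hb⟩
        · rcases a with _ | ⟨y, a⟩
          · simp at ha hb
            exact ⟨ha.symm, hb⟩
          · simp at hb
            simp [hb.2] at hjv
        · rcases a with _ | ⟨y, a⟩
          · simp at ha hb
            exact ⟨ha, hb.symm⟩
          · simp at hb
            simp [ha, ← hb.1] at hju
      exact h3.2 ▸ h
    · exfalso
      have he' : u ++ j :: v ++ [j] = (u' ++ i :: (v' ++ i :: w)) ++ [x] := by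
        simpa using he
      obtain ⟨h1, -⟩ := List.append_inj' he' rfl
      rw [h1] at hnd
      simp [List.nodup_append] at hnd

theorem sip_cons_iff {k : ℕ} {t : List ℕ} (ht : t.Perm (List.range k)) {j : ℕ}
    (hj : j + 2 ≤ k) : SIP (j :: t) ↔ ¬ Prec t j := by
  rw [← sip_reverse, List.reverse_cons,
    sip_append_singleton_iff ((List.reverse_perm t).trans ht) hj, prec_reverse ht hj]

/-! ### The blocks of the constant coefficient -/

section Coefficients

variable {S : Type*} [Ring S]

/-- The entries of `(1 ⊕ N) * ([B, 1; 1, 0] ⊕ 1)`. -/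
def extendRight (B : S) (N : ℕ → ℕ → S) : ℕ → ℕ → S
  | 0, 0 => B
  | 0, 1 => 1
  | 0, _ + 2 => 0
  | r + 1, 0 => N r 0
  | _ + 1, 1 => 0
  | r + 1, c + 2 => N r (c + 1)

open Classical in
/-- The entries of the product of the elementary matrices `M_0(-A_0), …, M_m(-A_m)` in which
`M_{j+1}` stands on the right of `M_j` if `c j` holds, and on the left otherwise. -/
noncomputable def fiedlerCoeff (c : ℕ → Prop) (A : ℕ → S) : ℕ → ℕ → ℕ → S
  | 0 => fun _ _ => -A 0
  | m + 1 => if c m then extendRight (-A (m + 1)) (fiedlerCoeff c A m) else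
      fun i j => extendRight (-A (m + 1)) (fun i' j' => fiedlerCoeff c A m j' i') j i

open Classical in
/-- The row order `l` and the column order `r` bring the pencil
`λ diag(A_k, 1, …, 1) - W` to the form of a block Kronecker pencil. -/
structure IsKroneckerOrder (k p q : ℕ) (l r : ℕ → ℕ) (W : ℕ → ℕ → S) (A : ℕ → S)
    (c d : ℕ → Prop) : Prop where
  size : p + q + 1 = k
  count_row : p = Nat.count d (k - 1)
  count_col : q = Nat.count c (k - 1)
  row_lt : ∀ i < k, l i < k
  col_lt : ∀ i < k, r i < k
  row_inj : ∀ i < k, ∀ j < k, l i = l j → i = j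
  col_inj : ∀ i < k, ∀ j < k, r i = r j → i = j
  row_zero : l 0 = 0
  col_zero : r 0 = 0
  entry_zero : W 0 0 = -A (k - 1)
  wingCol : ∀ i < k, ∀ t < q, W (l i) (r (p + 1 + t)) = if i = t then 1 else 0
  wingCol_diag : ∀ t < q, l (t + 1) = r (p + 1 + t)
  wingRow : ∀ j < k, ∀ t < p, W (l (q + 1 + t)) (r j) = if j = t then 1 else 0
  wingRow_diag : ∀ t < p, r (t + 1) = l (q + 1 + t)
  wingCol_pos : ∀ x, (∃ t < q, r (p + 1 + t) = x) ↔ ∃ j, j + 2 ≤ k ∧ c j ∧ x + j + 1 = k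
  wingRow_pos : ∀ x, (∃ t < p, l (q + 1 + t) = x) ↔ ∃ j, j + 2 ≤ k ∧ d j ∧ x + j + 1 = k
  antidiagonal : ∀ s ≤ k,
    (∑ i ∈ Finset.range (q + 1), ∑ j ∈ Finset.range (p + 1), if i + j + s = k then
      (if l i = r j then (if l i = 0 then A k else 1) else 0) else 0) +
    (∑ i ∈ Finset.range (q + 1), ∑ j ∈ Finset.range (p + 1), if i + j + s + 1 = k then
      -W (l i) (r j) else 0) = A s

/-! ### Adjoining a largest index to a Kronecker order -/

namespace IsKroneckerOrder

variable {k p q : ℕ} {l r : ℕ → ℕ} {W : ℕ → ℕ → S} {A : ℕ → S} {c d : ℕ → Prop}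

/-- The leading coefficient is block-diagonal, so the conditions are symmetric in rows and columns;
hence only adjunction on the right needs a separate argument. -/
theorem transpose (h : IsKroneckerOrder k p q l r W A c d) :
    IsKroneckerOrder k q p r l (fun i j => W j i) A d c where
  size := by have := h.size; omega
  count_row := h.count_col
  count_col := h.count_row
  row_lt := h.col_lt
  col_lt := h.row_lt
  row_inj := h.col_inj
  col_inj := h.row_inj
  row_zero := h.col_zero
  col_zero := h.row_zero
  entry_zero := h.entry_zero
  wingCol := h.wingRow
  wingCol_diag := h.wingRow_diag
  wingRow := h.wingCol
  wingRow_diag := h.wingCol_diag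
  wingCol_pos := h.wingRow_pos
  wingRow_pos := h.wingCol_pos
  antidiagonal := by
    intro s hs
    rw [← h.antidiagonal s hs, Finset.sum_comm]
    nth_rw 2 [Finset.sum_comm]
    congr 1
    · refine Finset.sum_congr rfl fun i _ => Finset.sum_congr rfl fun j _ => ?_
      simp only [add_comm j i, eq_comm (a := r j)]
      split_ifs <;> first | rfl | omega
    · simp only [add_comm]

/-- The row order after adjoining a largest index on the right. -/
def extendRow (l : ℕ → ℕ) : ℕ → ℕ
  | 0 => 0
  | i + 1 => l i + 1

/-- The column order after adjoining a largest index on the right. -/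
def extendCol (p : ℕ) (r : ℕ → ℕ) (j : ℕ) : ℕ :=
  if j = 0 then 0 else if j ≤ p then r j + 1 else if j = p + 1 then 1 else r (j - 1) + 1

theorem extendRight_succ_succ (B : S) (N : ℕ → ℕ → S) (i : ℕ) {j : ℕ} (hj : j ≠ 0) :
    extendRight B N (i + 1) (j + 1) = N i j := by
  obtain ⟨j, rfl⟩ := Nat.exists_eq_succ_of_ne_zero hj
  rfl

theorem extendRight_zero_succ (B : S) (N : ℕ → ℕ → S) {j : ℕ} (hj : j ≠ 0) :
    extendRight B N 0 (j + 1) = 0 := by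
  obtain ⟨j, rfl⟩ := Nat.exists_eq_succ_of_ne_zero hj
  rfl

/-- The inserted column 1 (from 0) is placed first among the wing columns, at place `p + 1` of the
column order. All other nonzero columns and all old rows move by one, which carries the old wing
conditions over. -/
theorem extend (h : IsKroneckerOrder k p q l r W A c d) (hc : c (k - 1)) (hd : ¬ d (k - 1)) :
    IsKroneckerOrder (k + 1) p (q + 1) (extendRow l) (extendCol p r)
      (extendRight (-A k) W) A c d := by
  have hs := h.size
  have hk : k - 1 + 1 = k := by omega
  have hr : ∀ j < k, j ≠ 0 → r j ≠ 0 := fun j hj h0 e =>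
    h0 (h.col_inj j hj 0 (by omega) (e.trans h.col_zero.symm))
  have hl : ∀ j < k, j ≠ 0 → l j ≠ 0 := fun j hj h0 e =>
    h0 (h.row_inj j hj 0 (by omega) (e.trans h.row_zero.symm))
  have hcol0 : extendCol p r 0 = 0 := rfl
  have hcol1 : ∀ j, j < p → extendCol p r (j + 1) = r (j + 1) + 1 := fun j hj => by
    simp [extendCol, Nat.succ_le_of_lt hj]
  have hcol2 : extendCol p r (p + 1) = 1 := by simp [extendCol]
  have hcol3 : ∀ t, extendCol p r (p + 1 + (t + 1)) = r (p + 1 + t) + 1 := fun t => by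
    unfold extendCol
    rw [if_neg (by omega), if_neg (by omega), if_neg (by omega)]
    rfl
  refine
  { size := by omega
    count_row := ?_
    count_col := ?_
    row_lt := ?_
    col_lt := ?_
    row_inj := ?_
    col_inj := ?_
    row_zero := rfl
    col_zero := rfl
    entry_zero := rfl
    wingCol := ?_
    wingCol_diag := ?_
    wingRow := ?_
    wingRow_diag := ?_
    wingCol_pos := ?_
    wingRow_pos := ?_
    antidiagonal := ?_ }
  · rw [Nat.add_sub_cancel, ← hk, Nat.count_succ, if_neg hd, ← h.count_row, add_zero]
  · rw [Nat.add_sub_cancel, ← hk, Nat.count_succ, if_pos hc, ← h.count_col]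
  · rintro (_ | i) hi
    · simp [extendRow]
    · have := h.row_lt i (by omega)
      simp only [extendRow]
      omega
  · intro j hj
    have h1 : j < k → r j < k := h.col_lt j
    have h2 : j - 1 < k → r (j - 1) < k := h.col_lt _
    unfold extendCol
    split_ifs <;> omega
  · rintro (_ | i) hi (_ | j) hj e
    · rfl
    · simp [extendRow] at e
    · simp [extendRow] at e
    · simp only [extendRow] at e
      rw [h.row_inj i (by omega) j (by omega) (by omega)]
  · intro i hi j hj e
    have h0 := hr i
    have h1 := hr (i - 1)
    have h2 := hr j
    have h3 := hr (j - 1)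
    have h4 := h.col_inj i
    have h5 := h.col_inj (i - 1)
    unfold extendCol at e
    split_ifs at e <;> first | omega | skip
    · have := h4 (by omega) j (by omega) (by omega)
      omega
    · have := h4 (by omega) (j - 1) (by omega) (by omega)
      omega
    · have := h5 (by omega) j (by omega) (by omega)
      omega
    · have := h5 (by omega) (j - 1) (by omega) (by omega)
      omega
  · rintro i hi (_ | t) ht
    · rw [add_zero, hcol2]
      rcases i with _ | i <;> simp [extendRow, extendRight]
    · rw [hcol3]
      have := hr (p + 1 + t) (by omega) (by omega)
      rcases i with _ | i
      · simp [extendRow, extendRight_zero_succ _ _ this]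
      · simp only [extendRow, extendRight_succ_succ _ _ _ this, Nat.add_right_cancel_iff]
        exact h.wingCol i (by omega) t (by omega)
  · rintro (_ | t) ht
    · rw [add_zero, hcol2]
      simp [extendRow, h.row_zero]
    · rw [hcol3, ← h.wingCol_diag t (by omega)]
      rfl
  · intro j hj t ht
    rw [show q + 1 + 1 + t = (q + 1 + t) + 1 by omega]
    simp only [extendRow]
    have h1 := h.wingRow
    rcases j with _ | j
    · rw [hcol0, ← h1 0 (by omega) t ht, h.col_zero]
      rfl
    · rcases lt_trichotomy j p with hjp | rfl | hjp
      · rw [hcol1 j hjp, extendRight_succ_succ _ _ _ (hr _ (by omega) (by omega))]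
        exact h1 _ (by omega) t ht
      · rw [hcol2, if_neg (by omega)]
        rfl
      · obtain ⟨u, rfl⟩ := Nat.exists_eq_add_of_lt hjp
        rw [show p + u + 1 + 1 = p + 1 + (u + 1) by omega, hcol3,
          extendRight_succ_succ _ _ _ (hr _ (by omega) (by omega)), h1 _ (by omega) t ht,
          if_neg (by omega), if_neg (by omega)]
  · intro t ht
    rw [hcol1 t ht, h.wingRow_diag t ht, show q + 1 + 1 + t = (q + 1 + t) + 1 by omega]
    rfl
  · intro x
    constructor
    · rintro ⟨_ | t, ht, rfl⟩
      · exact ⟨k - 1, by omega, hc, by rw [add_zero, hcol2]; omega⟩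
      · obtain ⟨j, h1, h2, h3⟩ := (h.wingCol_pos (r (p + 1 + t))).1 ⟨t, by omega, rfl⟩
        exact ⟨j, by omega, h2, by rw [hcol3]; omega⟩
    · rintro ⟨j, h1, h2, h3⟩
      by_cases hj : j + 2 ≤ k
      · obtain ⟨t, ht, h4⟩ := (h.wingCol_pos (x - 1)).2 ⟨j, hj, h2, by omega⟩
        exact ⟨t + 1, by omega, by rw [hcol3, h4]; omega⟩
      · exact ⟨0, by omega, by rw [add_zero, hcol2]; omega⟩
  · intro x
    constructor
    · rintro ⟨t, ht, rfl⟩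
      obtain ⟨j, h1, h2, h3⟩ := (h.wingRow_pos (l (q + 1 + t))).1 ⟨t, by omega, rfl⟩
      refine ⟨j, by omega, h2, ?_⟩
      rw [show q + 1 + 1 + t = (q + 1 + t) + 1 by omega]
      simp only [extendRow]
      omega
    · rintro ⟨j, h1, h2, h3⟩
      have hj : j ≠ k - 1 := fun e => hd (e ▸ h2)
      obtain ⟨t, ht, h4⟩ := (h.wingRow_pos (x - 1)).2 ⟨j, by omega, h2, by omega⟩
      refine ⟨t, ht, ?_⟩
      rw [show q + 1 + 1 + t = (q + 1 + t) + 1 by omega]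
      simp only [extendRow]
      omega
  · intro s hsk
    have hcolpos : ∀ j ∈ Finset.range p, ∃ y, extendCol p r (j + 1) = y + 1 ∧ y = r (j + 1) ∧
        y ≠ 0 := fun j hj => by
      rw [Finset.mem_range] at hj
      exact ⟨_, hcol1 j hj, rfl, hr _ (by omega) (by omega)⟩
    -- the leading coefficient
    have e1 : (∑ i ∈ Finset.range (q + 1 + 1), ∑ j ∈ Finset.range (p + 1),
        if i + j + s = k + 1 then (if extendRow l i = extendCol p r j then
          (if extendRow l i = 0 then A (k + 1) else 1) else 0) else 0) =
        (∑ i ∈ Finset.range (q + 1), ∑ j ∈ Finset.range (p + 1), if i + j + s = k then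
          (if l i = r j then (if l i = 0 then A k else 1) else 0) else 0) -
        (if s = k then A k else 0) + (if s = k + 1 then A (k + 1) else 0) := by
      -- The new first row contributes `A (k + 1)` at its corner only. The place of the old corner
      -- `A k` is now in column 0 below the diagonal, where the leading coefficient is 0; this is
      -- the subtracted term.
      rw [Finset.sum_range_succ' _ (q + 1)]
      congr 1
      · rw [Finset.sum_range_succ' _ q, Finset.sum_range_succ' _ q, add_sub_assoc]
        congr 1
        · refine Finset.sum_congr rfl fun i hi => Finset.sum_congr rfl fun j hj => ?_
          rw [Finset.mem_range] at hi hj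
          have hli := hl (i + 1) (by omega) (by omega)
          have hc : i + 1 + 1 + j + s = k + 1 ↔ i + 1 + j + s = k := by omega
          simp only [extendRow, hc, hli, if_false]
          rcases j with _ | j
          · simp [hcol0, h.col_zero, hli]
          · simp [hcol1 j (by omega)]
        · rw [Finset.sum_range_succ' _ p, Finset.sum_range_succ' _ p, add_sub_assoc]
          have : ∀ j ∈ Finset.range p, (if 0 + 1 + (j + 1) + s = k + 1 then
              (if extendRow l (0 + 1) = extendCol p r (j + 1) then
              (if extendRow l (0 + 1) = 0 then A (k + 1) else 1) else 0) else 0) =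
              if 0 + (j + 1) + s = k then
                (if l 0 = r (j + 1) then (if l 0 = 0 then A k else 1) else 0) else 0 := by
            intro j hj
            obtain ⟨y, h1, h2, h3⟩ := hcolpos j hj
            rw [h1, ← h2]
            simp [extendRow, h.row_zero, h3, h3.symm]
          rw [Finset.sum_congr rfl this]
          congr 1
          simp [extendRow, hcol0, h.row_zero, h.col_zero]
      · rw [Finset.sum_range_succ' _ p, Finset.sum_eq_zero, zero_add]
        · simp [extendRow, hcol0]
        · intro j hj
          obtain ⟨y, h1, h2, h3⟩ := hcolpos j hj
          simp [h1, extendRow]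
    -- the constant coefficient
    have e2 : (∑ i ∈ Finset.range (q + 1 + 1), ∑ j ∈ Finset.range (p + 1),
        if i + j + s + 1 = k + 1 then
          -extendRight (-A k) W (extendRow l i) (extendCol p r j) else 0) =
        (∑ i ∈ Finset.range (q + 1), ∑ j ∈ Finset.range (p + 1), if i + j + s + 1 = k then
          -W (l i) (r j) else 0) + (if s = k then A k else 0) := by
      -- The new first row contributes only its corner, which restores the `A k` lost in `e1`.
      rw [Finset.sum_range_succ' _ (q + 1)]
      congr 1
      · refine Finset.sum_congr rfl fun i hi => Finset.sum_congr rfl fun j hj => ?_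
        rw [Finset.mem_range] at hi hj
        have hc : i + 1 + j + s + 1 = k + 1 ↔ i + j + s + 1 = k := by omega
        simp only [extendRow, hc]
        rcases j with _ | j
        · rw [hcol0, h.col_zero]
          rfl
        · rw [hcol1 j (by omega), extendRight_succ_succ _ _ _ (hr _ (by omega) (by omega))]
      · rw [Finset.sum_range_succ' _ p, Finset.sum_eq_zero, zero_add]
        · simp [extendRow, hcol0, extendRight]
        · intro j hj
          obtain ⟨y, h1, h2, h3⟩ := hcolpos j hj
          simp [h1, extendRow, extendRight_zero_succ _ _ h3]
    rw [e1, e2]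
    -- The value `k + 1` is beyond the old AS condition, but there both old sums are empty.
    by_cases hsk' : s = k + 1
    · subst hsk'
      rw [Finset.sum_eq_zero, Finset.sum_eq_zero]
      · simp
      · intro i _
        refine Finset.sum_eq_zero fun j _ => ?_
        rw [if_neg (by omega)]
      · intro i _
        refine Finset.sum_eq_zero fun j _ => ?_
        rw [if_neg (by omega)]
    · rw [if_neg hsk', ← h.antidiagonal s (by omega)]
      abel

end IsKroneckerOrder

theorem exists_isKroneckerOrder (c : ℕ → Prop) (A : ℕ → S) (m : ℕ) :
    ∃ p q l r, IsKroneckerOrder (m + 1) p q l r (fiedlerCoeff c A m) A c (fun j => ¬ c j) := by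
  induction m with
  | zero =>
    refine ⟨0, 0, id, id, ?_⟩
    constructor <;> simp [fiedlerCoeff]
    intro s hs
    interval_cases s <;> simp
  | succ m ih =>
    obtain ⟨p, q, l, r, h⟩ := ih
    by_cases hc : c m
    · have := h.extend (by simpa using hc) (by simpa using hc)
      rw [fiedlerCoeff, if_pos hc]
      exact ⟨_, _, _, _, this⟩
    -- The new index stands on the left: block-transposition exchanges the roles of `c` and its
    -- negation.
    · have := (h.transpose.extend (by simpa using hc) (by simpa using hc)).transpose
      rw [fiedlerCoeff, if_neg hc]
      exact ⟨_, _, _, _, this⟩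

end Coefficients

/-! ### Products of elementary matrices -/

section Elementary

variable {S : Type*} [Ring S] {k : ℕ}

/-- The blocks of the elementary matrix `M_i(B)`, as a matrix over the ring of blocks. -/
def elementaryBlocks (k i : ℕ) (B : S) : Matrix (Fin k) (Fin k) S :=
  Matrix.of fun r c =>
    if (r : ℕ) + i + 1 = k ∧ (c : ℕ) + i + 1 = k then B
    else if (r : ℕ) + i + 1 = k ∧ (c : ℕ) + i = k then 1
    else if (r : ℕ) + i = k ∧ (c : ℕ) + i + 1 = k then 1
    else if (r : ℕ) + i = k ∧ (c : ℕ) + i = k then 0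
    else if r = c then 1 else 0

theorem elementaryBlocks_sub_one_apply {i : ℕ} {B : S} {r c : Fin k}
    (h : ¬ (((r : ℕ) + i + 1 = k ∨ (r : ℕ) + i = k) ∧ ((c : ℕ) + i + 1 = k ∨ (c : ℕ) + i = k))) :
    (elementaryBlocks k i B - 1) r c = 0 := by
  simp only [elementaryBlocks, Matrix.sub_apply, Matrix.of_apply, Matrix.one_apply]
  rw [if_neg (by tauto), if_neg (by tauto), if_neg (by tauto), if_neg (by tauto), sub_self]

/-- `M_i(B) - 1` lives in the rows and columns `k - i - 1` and `k - i` (from 0); for nonadjacent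
distinct indices these supports are disjoint. -/
theorem elementaryBlocks_sub_one_mul {i j : ℕ} (h1 : i ≠ j) (h2 : i ≠ j + 1) (h3 : j ≠ i + 1)
    (B B' : S) : (elementaryBlocks k i B - 1) * (elementaryBlocks k j B' - 1) = 0 := by
  ext r s
  rw [Matrix.mul_apply, Matrix.zero_apply]
  refine Finset.sum_eq_zero fun t _ => ?_
  by_cases ht : (t : ℕ) + i + 1 = k ∨ (t : ℕ) + i = k
  · rw [elementaryBlocks_sub_one_apply (i := j) (by omega), mul_zero]
  · rw [elementaryBlocks_sub_one_apply (i := i) (by omega), zero_mul]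

theorem elementaryBlocks_commute {i j : ℕ} (h1 : i ≠ j) (h2 : i ≠ j + 1) (h3 : j ≠ i + 1)
    (B B' : S) : Commute (elementaryBlocks k i B) (elementaryBlocks k j B') := by
  have h : Commute (elementaryBlocks k i B - 1) (elementaryBlocks k j B' - 1) := by
    rw [Commute, SemiconjBy, elementaryBlocks_sub_one_mul h1 h2 h3,
      elementaryBlocks_sub_one_mul h1.symm h3 h2]
  simpa using (h.add_left (Commute.one_left _)).add_right
    ((Commute.one_right (elementaryBlocks k i B - 1 + 1)))

theorem TupleEquiv.prod_elementaryBlocks_eq {t t' : List ℕ} (h : TupleEquiv t t') (A : ℕ → S) :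
    (t.map fun i => elementaryBlocks k i (A i)).prod =
      (t'.map fun i => elementaryBlocks k i (A i)).prod := by
  induction h with
  | refl => rfl
  | tail _ h ih =>
    rw [ih]
    obtain ⟨u, v, a, b, h1, h2, h3⟩ := h
    simp only [List.map_append, List.map_cons, List.prod_append, List.prod_cons, ← mul_assoc]
    rw [mul_assoc (List.prod _), (elementaryBlocks_commute h1 h2 h3 _ _).eq, ← mul_assoc]

/-- The matrix `1 ⊕ N`. -/
def border (N : Matrix (Fin k) (Fin k) S) : Matrix (Fin (k + 1)) (Fin (k + 1)) S :=
  Matrix.of (Fin.cons (Fin.cons 1 0) fun i => Fin.cons 0 (N i))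

@[simp] theorem border_zero_zero (N : Matrix (Fin k) (Fin k) S) : border N 0 0 = 1 := rfl

@[simp] theorem border_zero_succ (N : Matrix (Fin k) (Fin k) S) (j : Fin k) :
    border N 0 j.succ = 0 := rfl

@[simp] theorem border_succ_zero (N : Matrix (Fin k) (Fin k) S) (i : Fin k) :
    border N i.succ 0 = 0 := rfl

@[simp] theorem border_succ_succ (N : Matrix (Fin k) (Fin k) S) (i j : Fin k) :
    border N i.succ j.succ = N i j := rfl

theorem border_one : border (1 : Matrix (Fin k) (Fin k) S) = 1 := by
  ext i j
  cases i using Fin.cases <;> cases j using Fin.cases <;>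
    simp [Matrix.one_apply, (Fin.succ_ne_zero _).symm]

theorem border_mul (M N : Matrix (Fin k) (Fin k) S) : border (M * N) = border M * border N := by
  ext i j
  cases i using Fin.cases <;> cases j using Fin.cases <;>
    simp [Matrix.mul_apply, Fin.sum_univ_succ]

/-- The nontrivial part of `M_i(B)` has a fixed distance from the lower right corner, so enlarging
the size only adds a 1 at the upper left. -/
theorem elementaryBlocks_succ {i : ℕ} (hi : i < k) (B : S) :
    elementaryBlocks (k + 1) i B = border (elementaryBlocks k i B) := by
  have hk : i ≠ k := hi.ne
  have hk' : i ≠ k + 1 := by omega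
  ext r c
  cases r using Fin.cases with
  | zero =>
    cases c using Fin.cases with
    | zero => simp [elementaryBlocks, hk, hk']
    | succ c => simp [elementaryBlocks, hk, hk', (Fin.succ_ne_zero c).symm]
  | succ r =>
    cases c using Fin.cases with
    | zero => simp [elementaryBlocks, hk, hk']
    | succ c =>
      simp only [elementaryBlocks, Matrix.of_apply, Fin.val_succ, border_succ_succ, Fin.succ_inj]
      have h1 : ∀ x : ℕ, x + 1 + i + 1 = k + 1 ↔ x + i + 1 = k := by omega
      have h2 : ∀ x : ℕ, x + 1 + i = k + 1 ↔ x + i = k := by omega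
      simp only [h1, h2]

theorem prod_elementaryBlocks_succ {t : List ℕ} (ht : ∀ i ∈ t, i < k) (A : ℕ → S) :
    (t.map fun i => elementaryBlocks (k + 1) i (A i)).prod =
      border (t.map fun i => elementaryBlocks k i (A i)).prod := by
  induction t with
  | nil => simp [border_one]
  | cons a t ih =>
    rw [List.map_cons, List.prod_cons, ih fun i hi => ht i (by simp [hi]),
      elementaryBlocks_succ (ht a (by simp)), ← border_mul]
    rfl

theorem elementaryBlocks_zero_apply {m : ℕ} (B : S) (t : Fin (m + 2)) :
    elementaryBlocks (m + 2) (m + 1) B 0 t = if t = 0 then B else if t = 1 then 1 else 0 := by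
  have h : ∀ x : Fin (m + 2), (x : ℕ) = 0 → elementaryBlocks (m + 2) (m + 1) B x t =
      if t = 0 then B else if t = 1 then 1 else 0 := by
    intro x hx
    have h0 : t = 0 ↔ (t : ℕ) = 0 := Fin.ext_iff
    have h1 : t = 1 ↔ (t : ℕ) = 1 := Fin.ext_iff
    simp only [elementaryBlocks, Matrix.of_apply, Fin.ext_iff (a := x), h0, h1]
    split_ifs <;> first | rfl | omega
  exact h 0 rfl

theorem elementaryBlocks_one_apply {m : ℕ} (B : S) (t : Fin (m + 2)) :
    elementaryBlocks (m + 2) (m + 1) B 1 t = if t = 0 then 1 else 0 := by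
  have h : ∀ x : Fin (m + 2), (x : ℕ) = 1 → elementaryBlocks (m + 2) (m + 1) B x t =
      if t = 0 then 1 else 0 := by
    intro x hx
    have h0 : t = 0 ↔ (t : ℕ) = 0 := Fin.ext_iff
    simp only [elementaryBlocks, Matrix.of_apply, Fin.ext_iff (a := x), h0]
    split_ifs <;> first | rfl | omega
  exact h 1 rfl

theorem elementaryBlocks_succ_succ_apply {m : ℕ} (B : S) (s : Fin m) (t : Fin (m + 2)) :
    elementaryBlocks (m + 2) (m + 1) B s.succ.succ t = if s.succ.succ = t then 1 else 0 := by
  simp only [elementaryBlocks, Matrix.of_apply, Fin.ext_iff, Fin.val_succ]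
  split_ifs <;> first | rfl | omega

theorem border_mul_elementaryBlocks {m : ℕ} (N : Matrix (Fin (m + 1)) (Fin (m + 1)) S)
    (W : ℕ → ℕ → S) (h : ∀ i j : Fin (m + 1), N i j = W i j) (B : S) (i j : Fin (m + 2)) :
    (border N * elementaryBlocks (m + 2) (m + 1) B) i j = extendRight B W i j := by
  rw [Matrix.mul_apply, Fin.sum_univ_succ, Fin.sum_univ_succ]
  simp only [Fin.succ_zero_eq_one, elementaryBlocks_zero_apply, elementaryBlocks_one_apply,
    elementaryBlocks_succ_succ_apply]
  cases i using Fin.cases with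
  | zero =>
    have h1 : border N 0 1 = 0 := rfl
    cases j using Fin.cases with
    | zero => simp [h1, extendRight]
    | succ j =>
      cases j using Fin.cases with
      | zero => simp [h1, extendRight]
      | succ j =>
        simp [h1, extendRight, Fin.ext_iff]
  | succ i =>
    have h1 : border N i.succ 1 = N i 0 := rfl
    cases j using Fin.cases with
    | zero => simp [h1, extendRight, h]
    | succ j =>
      cases j using Fin.cases with
      | zero => simp [h1, extendRight, Fin.ext_iff]
      | succ j => simp [h1, extendRight, h]

/-- Block-transposition does not reverse products over a noncommutative ring, so this is computed
separately from `border_mul_elementaryBlocks`. The symmetry survives because no entry of the product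
involves a product of two nontrivial blocks. -/
theorem elementaryBlocks_mul_border {m : ℕ} (N : Matrix (Fin (m + 1)) (Fin (m + 1)) S)
    (W : ℕ → ℕ → S) (h : ∀ i j : Fin (m + 1), N i j = W i j) (B : S) (i j : Fin (m + 2)) :
    (elementaryBlocks (m + 2) (m + 1) B * border N) i j =
      extendRight B (fun i' j' => W j' i') j i := by
  rw [Matrix.mul_apply]
  cases i using Fin.cases with
  | zero =>
    rw [Fin.sum_univ_succ, Fin.sum_univ_succ]
    have h1 : ∀ j, border N 1 (Fin.succ j) = N 0 j := fun j => rfl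
    have h2 : border N 1 0 = 0 := rfl
    simp only [Fin.succ_zero_eq_one, elementaryBlocks_zero_apply]
    cases j using Fin.cases with
    | zero => simp [h2, extendRight, Fin.ext_iff]
    | succ j => simp [h1, extendRight, h, Fin.ext_iff]
  | succ i =>
    cases i using Fin.cases with
    | zero =>
      simp only [Fin.succ_zero_eq_one, elementaryBlocks_one_apply]
      cases j using Fin.cases <;> simp [extendRight]
    | succ i =>
      simp only [elementaryBlocks_succ_succ_apply]
      cases j using Fin.cases <;> simp [extendRight, h]

/-- The product of elementary matrices depends only on the relative order of consecutive
indices. -/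
theorem prod_elementaryBlocks_apply (A : ℕ → S) (m : ℕ) (c : ℕ → Prop) :
    ∀ t : List ℕ, t.Perm (List.range (m + 1)) → (∀ j < m, Prec t j ↔ c j) →
      ∀ i j : Fin (m + 1), (t.map fun i => elementaryBlocks (m + 1) i (-A i)).prod i j =
        fiedlerCoeff c A m i j := by
  induction m with
  | zero =>
    intro t ht _ i j
    rw [List.perm_singleton.1 (show t.Perm [0] from ht)]
    simp [fiedlerCoeff, elementaryBlocks]
  | succ m ih =>
    intro t ht hc i j
    obtain ⟨t', ht', hprec, h⟩ := exists_tupleEquiv_largest ht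
    have hlt : ∀ i ∈ t', i < m + 1 := fun i hi => List.mem_range.1 (ht'.mem_iff.1 hi)
    have hN := ih t' ht' fun j hj => (hprec j hj).trans (hc j (by omega))
    rcases h with ⟨h, he⟩ | ⟨h, he⟩
    · rw [he.prod_elementaryBlocks_eq (fun i => -A i), List.map_append, List.prod_append,
        prod_elementaryBlocks_succ hlt, fiedlerCoeff, if_pos ((hc m (by omega)).1 h)]
      simpa using border_mul_elementaryBlocks _ _ hN _ i j
    · rw [he.prod_elementaryBlocks_eq (fun i => -A i), List.map_cons, List.prod_cons,
        prod_elementaryBlocks_succ hlt, fiedlerCoeff, if_neg fun e => h ((hc m (by omega)).2 e)]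
      simpa using elementaryBlocks_mul_border _ _ hN _ i j

end Elementary

/-! ### Entries of the Fiedler pencil and of block matrices -/

section Assembly

variable {R : Type*} {k n : ℕ}

theorem ofBlocks_mul [Ring R] (f g : Matrix (Fin k) (Fin k) (Matrix (Fin n) (Fin n) R)) :
    ofBlocks f * ofBlocks g = ofBlocks (f * g) := by
  ext ⟨i, a⟩ ⟨j, b⟩
  simp only [ofBlocks, Matrix.mul_apply, Matrix.of_apply, Fintype.sum_prod_type, Matrix.sum_apply]

theorem ofBlocks_one [Ring R] :
    ofBlocks (1 : Matrix (Fin k) (Fin k) (Matrix (Fin n) (Fin n) R)) = 1 := by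
  ext ⟨i, a⟩ ⟨j, b⟩
  by_cases h : i = j
  · simp [ofBlocks, Matrix.one_apply, h]
  · simp [ofBlocks, Matrix.one_apply, h]

theorem blockTranspose_blockPerm_mul [Ring R] {ι : Type*} (c : Equiv.Perm (Fin k))
    (H : Matrix (Fin k × Fin n) ι R) (i : Fin k) (a : Fin n) (y : ι) :
    (blockTranspose (blockPerm R n c) * H) (i, a) y = H (c i, a) y := by
  rw [Matrix.mul_apply, Fintype.sum_prod_type, Finset.sum_eq_single (c i),
    Finset.sum_eq_single a]
  · simp [blockTranspose, blockPerm, ofBlocks, block]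
  · intro b _ hb
    simp [blockTranspose, blockPerm, ofBlocks, block, hb.symm]
  · simp
  · intro b _ hb
    simp [blockTranspose, blockPerm, ofBlocks, block, hb]
  · simp

theorem mul_blockPerm [Ring R] {ι : Type*} (c : Equiv.Perm (Fin k))
    (H : Matrix ι (Fin k × Fin n) R) (x : ι) (j : Fin k) (b : Fin n) :
    (H * blockPerm R n c) x (j, b) = H x (c j, b) := by
  rw [Matrix.mul_apply, Fintype.sum_prod_type, Finset.sum_eq_single (c j),
    Finset.sum_eq_single b]
  · simp [blockPerm, ofBlocks]
  · intro a _ ha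
    simp [blockPerm, ofBlocks, ha]
  · simp
  · intro a _ ha
    simp [blockPerm, ofBlocks, ha]
  · simp

variable {F : Type*} [Field F]

theorem elementaryProd_apply {m : ℕ} (P : Matrix (Fin n) (Fin n) F[X]) {t : List ℕ}
    (ht : t.Perm (List.range (m + 1))) (i j : Fin (m + 1)) (a b : Fin n) :
    elementaryProd (m + 1) P t (i, a) (j, b) = fiedlerCoeff (Prec t) (coeffMatrix P) m i j a b := by
  rw [← prod_elementaryBlocks_apply (coeffMatrix P) m (Prec t) t ht fun _ _ => Iff.rfl]
  have : ∀ t : List ℕ, elementaryProd (m + 1) P t = ofBlocks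
      (t.map fun i => elementaryBlocks (m + 1) i (-(coeffMatrix P i))).prod := by
    intro t
    induction t with
    | nil => exact ofBlocks_one.symm
    | cons x t ih =>
      rw [List.map_cons, List.prod_cons, ← ofBlocks_mul, ← ih]
      rfl
  rw [this]
  rfl

theorem fiedlerPencil_apply {m : ℕ} (P : Matrix (Fin n) (Fin n) F[X]) {t : List ℕ}
    (ht : t.Perm (List.range (m + 1))) (i j : Fin (m + 1)) (a b : Fin n) :
    fiedlerPencil (m + 1) P t (i, a) (j, b) =
      X * C ((if (i : ℕ) = j then (if (i : ℕ) = 0 then coeffMatrix P (m + 1) else 1)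
        else (0 : Matrix (Fin n) (Fin n) F)) a b) -
      C (fiedlerCoeff (Prec t) (coeffMatrix P) m i j a b) := by
  rw [fiedlerPencil, Matrix.sub_apply, Matrix.map_apply, elementaryProd_apply P ht,
    Matrix.smul_apply, Matrix.map_apply, smul_eq_mul]
  simp only [elementaryNegLast, ofBlocks, Matrix.of_apply, Fin.ext_iff]

theorem fiedlerPencil_coeff {m : ℕ} (P : Matrix (Fin n) (Fin n) F[X]) {t : List ℕ}
    (ht : t.Perm (List.range (m + 1))) (i j : Fin (m + 1)) (a b : Fin n) :
    (fiedlerPencil (m + 1) P t (i, a) (j, b)).natDegree ≤ 1 ∧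
    (fiedlerPencil (m + 1) P t (i, a) (j, b)).coeff 1 =
      (if (i : ℕ) = j then (if (i : ℕ) = 0 then coeffMatrix P (m + 1) else 1) else 0) a b ∧
    (fiedlerPencil (m + 1) P t (i, a) (j, b)).coeff 0 =
      (-fiedlerCoeff (Prec t) (coeffMatrix P) m i j) a b := by
  rw [fiedlerPencil_apply P ht]
  refine ⟨?_, ?_, ?_⟩
  · compute_degree
  · simp [coeff_C]
  · simp [coeff_C]

theorem C_one_apply (a b : Fin n) :
    C ((1 : Matrix (Fin n) (Fin n) F) a b) = (1 : Matrix (Fin n) (Fin n) F[X]) a b := by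
  by_cases h : a = b <;> simp [Matrix.one_apply, h]

/-- The permutation of `Fin k` given by an injective map on the natural numbers below `k`. -/
noncomputable def permOfInjOn (f : ℕ → ℕ) (hf : ∀ i < k, f i < k)
    (hinj : ∀ i < k, ∀ j < k, f i = f j → i = j) : Equiv.Perm (Fin k) :=
  Equiv.ofBijective (fun i => ⟨f i, hf i i.2⟩) (Finite.injective_iff_bijective.1 fun i j h =>
    Fin.ext (hinj i i.2 j j.2 (Fin.mk.inj h)))

@[simp] theorem permOfInjOn_val (f : ℕ → ℕ) (hf : ∀ i < k, f i < k)
    (hinj : ∀ i < k, ∀ j < k, f i = f j → i = j) (i : Fin k) :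
    (permOfInjOn f hf hinj i : ℕ) = f i := rfl

theorem splitBlocks_inl {a b : ℕ} (h : a + b = k) (i : Fin a) (x : Fin n) :
    splitBlocks n h (Sum.inl (i, x)) = (⟨i, by omega⟩, x) := rfl

theorem splitBlocks_inr {a b : ℕ} (h : a + b = k) (i : Fin b) (x : Fin n) :
    splitBlocks n h (Sum.inr (i, x)) = (⟨a + i, by omega⟩, x) := rfl

end Assembly

/-! ### Wing block-columns and block-rows of the Fiedler pencil -/

namespace IsKroneckerOrder

variable {F : Type*} [Field F] {m n p q : ℕ} {P : Matrix (Fin n) (Fin n) F[X]} {t : List ℕ}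
  {l r : ℕ → ℕ}

theorem row_ne_zero {S : Type*} [Ring S] {k p q : ℕ} {W : ℕ → ℕ → S} {A : ℕ → S}
    {c d : ℕ → Prop} (h : IsKroneckerOrder k p q l r W A c d) {j : ℕ} (hj : j < k)
    (h0 : j ≠ 0) : l j ≠ 0 := fun e =>
  h0 (h.row_inj j hj 0 (by omega) (e.trans h.row_zero.symm))

/-- The `-1` comes from the constant coefficient, the `λ` from the diagonal. The diagonal is met in
row place `s + 1`, which is not the first row, so its block is `1` and not `A_k`. -/
theorem fiedlerPencil_wingCol
    (h : IsKroneckerOrder (m + 1) p q l r (fiedlerCoeff (Prec t) (coeffMatrix P) m)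
      (coeffMatrix P) (Prec t) (fun j => ¬ Prec t j))
    (ht : t.Perm (List.range (m + 1))) (i : Fin (m + 1)) (s : ℕ) (hs : s < q) (a b : Fin n)
    (x y : Fin (m + 1)) (hx : (x : ℕ) = l i) (hy : (y : ℕ) = r (p + 1 + s)) :
    fiedlerPencil (m + 1) P t (x, a) (y, b) =
      (if (i : ℕ) = s then -1 else if (i : ℕ) = s + 1 then X else 0) *
        (1 : Matrix (Fin n) (Fin n) F[X]) a b := by
  have hsize := h.size
  have hdiag : l i = r (p + 1 + s) ↔ (i : ℕ) = s + 1 := by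
    rw [← h.wingCol_diag s hs]
    exact ⟨h.row_inj _ i.2 _ (by omega), fun e => by rw [e]⟩
  rw [fiedlerPencil_apply P ht, hx, hy, h.wingCol i i.2 s hs]
  simp only [hdiag]
  rw [← C_one_apply]
  by_cases h1 : (i : ℕ) = s
  · simp [h1]
  · by_cases h2 : (i : ℕ) = s + 1
    · simp [h2, h.row_ne_zero (show s + 1 < m + 1 by omega)]
    · simp [h1, h2]

theorem fiedlerPencil_wingRow
    (h : IsKroneckerOrder (m + 1) p q l r (fiedlerCoeff (Prec t) (coeffMatrix P) m)
      (coeffMatrix P) (Prec t) (fun j => ¬ Prec t j))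
    (ht : t.Perm (List.range (m + 1))) (j : Fin (m + 1)) (s : ℕ) (hs : s < p) (a b : Fin n)
    (x y : Fin (m + 1)) (hx : (x : ℕ) = l (q + 1 + s)) (hy : (y : ℕ) = r j) :
    fiedlerPencil (m + 1) P t (x, a) (y, b) =
      (if (j : ℕ) = s then -1 else if (j : ℕ) = s + 1 then X else 0) *
        (1 : Matrix (Fin n) (Fin n) F[X]) a b := by
  have hsize := h.size
  have hdiag : l (q + 1 + s) = r j ↔ (j : ℕ) = s + 1 := by
    rw [← h.wingRow_diag s hs]
    exact ⟨fun e => (h.col_inj _ (by omega) _ j.2 e).symm, fun e => by rw [e]⟩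
  rw [fiedlerPencil_apply P ht, hx, hy, h.wingRow j j.2 s hs]
  simp only [hdiag, h.row_ne_zero (show q + 1 + s < m + 1 by omega) (by omega), if_false]
  rw [← C_one_apply]
  by_cases h1 : (j : ℕ) = s
  · simp [h1]
  · by_cases h2 : (j : ℕ) = s + 1
    · simp [h2]
    · simp [h1, h2]

theorem mem_wingCols {S : Type*} [Ring S] {k p q : ℕ} {W : ℕ → ℕ → S} {A : ℕ → S}
    {c d : ℕ → Prop} (h : IsKroneckerOrder k p q l r W A c d) (x : Fin k) :
    x ∈ wingCols (permOfInjOn r h.col_lt h.col_inj) p ↔ ∃ t < q, r (p + 1 + t) = x := by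
  have hsize := h.size
  constructor
  · rintro ⟨i, hi, rfl⟩
    obtain ⟨t, ht⟩ := Nat.exists_eq_add_of_le hi
    exact ⟨t, by omega, by rw [permOfInjOn_val, ht]⟩
  · rintro ⟨t, ht, hx⟩
    exact ⟨⟨p + 1 + t, by omega⟩, by simp, Fin.ext hx⟩

theorem mem_wingRows {S : Type*} [Ring S] {k p q : ℕ} {W : ℕ → ℕ → S} {A : ℕ → S}
    {c d : ℕ → Prop} (h : IsKroneckerOrder k p q l r W A c d) (x : Fin k) :
    x ∈ wingRows (permOfInjOn l h.row_lt h.row_inj) q ↔ ∃ t < p, l (q + 1 + t) = x :=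
  h.transpose.mem_wingCols x

end IsKroneckerOrder

end FiedlerKronecker

/-! ### Assembly of the theorem -/

theorem theorem6p2 {F : Type*} [Field F] (k n : ℕ) (hk : 0 < k)
    (P : Matrix (Fin n) (Fin n) F[X]) (hP : HasGrade P k)
    (q : List ℕ) (hq : q.Perm (List.range k)) :
    ∃ (p' q' : ℕ) (h : p' + q' + 1 = k),
      numHeads q = p' + 1 ∧
      numHeads q.reverse = q' + 1 ∧
      ∃ (l r : Equiv.Perm (Fin k))
        (M : Matrix (Fin (q' + 1) × Fin n) (Fin (p' + 1) × Fin n) F[X]),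
        -- block-permutational equivalence to a block Kronecker pencil; AS condition
        IsBlockKronecker p' q' h M
          (blockTranspose (blockPerm F[X] n l) *
            fiedlerPencil k P q * blockPerm F[X] n r) ∧
        SatisfiesAS M P ∧
        -- form and positions of the wing block-columns
        blockCol
            (blockTranspose (blockPerm F[X] n l) *
              fiedlerPencil k P q) '' wingCols r p' =
          {K | ∃ i < q', K = wingColForm F k n i} ∧
        wingCols r p' =
          {c : Fin k | ∃ j : ℕ, j + 2 ≤ k ∧ j ∉ heads q ∧ (c : ℕ) + 1 = k - j} ∧
        wingCols r p' =
          {c : Fin k | ∃ j : ℕ, j + 2 ≤ k ∧ SIP (q ++ [j]) ∧ (c : ℕ) + 1 = k - j} ∧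
        -- form and positions of the wing block-rows
        blockRow
            (fiedlerPencil k P q * blockPerm F[X] n r) ''
              wingRows l q' =
          {K | ∃ i < p', K = wingRowForm F k n i} ∧
        wingRows l q' =
          {c : Fin k | ∃ j : ℕ, j + 2 ≤ k ∧ j ∉ heads q.reverse ∧
            (c : ℕ) + 1 = k - j} ∧
        wingRows l q' =
          {c : Fin k | ∃ j : ℕ, j + 2 ≤ k ∧ SIP (j :: q) ∧ (c : ℕ) + 1 = k - j} ∧
        -- the first block-row and block-column come first; the first block-entry of the body
        l ⟨0, hk⟩ = ⟨0, hk⟩ ∧ r ⟨0, hk⟩ = ⟨0, hk⟩ ∧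
        block M 0 0 =
          (X : F[X]) • (coeffMatrix P k).map C +
            (coeffMatrix P (k - 1)).map C := by
  obtain ⟨m, rfl⟩ : ∃ m, k = m + 1 := ⟨k - 1, by omega⟩
  obtain ⟨p, s, l, r, h⟩ := exists_isKroneckerOrder (Prec q) (coeffMatrix P) m
  have hsize := h.size
  have hrev : q.reverse.Perm (List.range (m + 1)) := (List.reverse_perm q).trans hq
  have hlt : ∀ i : Fin (s + 1), (i : ℕ) < m + 1 := fun i => by omega
  have hlt' : ∀ i : Fin (p + 1), (i : ℕ) < m + 1 := fun i => by omega
  set L := permOfInjOn l h.row_lt h.row_inj with hL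
  set R := permOfInjOn r h.col_lt h.col_inj with hR
  have hcols : ∀ Q : ℕ → Prop, (∀ j, j + 2 ≤ m + 1 → (Q j ↔ Prec q j)) → wingCols R p =
      {c : Fin (m + 1) | ∃ j : ℕ, j + 2 ≤ m + 1 ∧ Q j ∧ (c : ℕ) + 1 = m + 1 - j} := by
    intro Q hQ
    ext c
    rw [hR, h.mem_wingCols, h.wingCol_pos]
    refine exists_congr fun j => and_congr_right fun hj => ?_
    rw [hQ j hj]
    refine and_congr_right fun _ => ?_
    omega
  have hrows : ∀ Q : ℕ → Prop, (∀ j, j + 2 ≤ m + 1 → (Q j ↔ ¬ Prec q j)) → wingRows L s =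
      {c : Fin (m + 1) | ∃ j : ℕ, j + 2 ≤ m + 1 ∧ Q j ∧ (c : ℕ) + 1 = m + 1 - j} := by
    intro Q hQ
    ext c
    rw [hL, h.mem_wingRows, h.wingRow_pos]
    refine exists_congr fun j => and_congr_right fun hj => ?_
    rw [hQ j hj]
    refine and_congr_right fun _ => ?_
    omega
  have hhead : ∀ t : List ℕ, t.Perm (List.range (m + 1)) → ∀ j, j + 2 ≤ m + 1 →
      (j ∉ heads t ↔ Prec t j) := by
    intro t ht j hj
    rw [mem_heads_iff ht hk]
    constructor
    · intro hn
      by_contra hp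
      exact hn ⟨by omega, fun _ => hp⟩
    · exact fun hp hn => hn.2 hj hp
  refine ⟨p, s, hsize, ?_, ?_, L, R,
    Matrix.of fun x y => fiedlerPencil (m + 1) P q (L ⟨x.1, hlt x.1⟩, x.2) (R ⟨y.1, hlt' y.1⟩, y.2),
    ⟨?_, ?_⟩, ?_, ?_, hcols _ (hhead q hq), hcols _ fun j hj => sip_append_singleton_iff hq hj, ?_,
    hrows _ fun j hj => (hhead _ hrev j hj).trans (prec_reverse hq hj),
    hrows _ fun j hj => sip_cons_iff hq hj, Fin.ext h.row_zero, Fin.ext h.col_zero, ?_⟩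
  · rw [h.count_row]
    exact numHeads_eq hq _ fun _ _ => Iff.rfl
  · rw [h.count_col]
    exact numHeads_eq hrev _ fun j hj => by rw [prec_reverse hq (by omega), not_not]
  · rintro ⟨i, a⟩ ⟨j, b⟩
    exact (fiedlerPencil_coeff P hq _ _ a b).1
  · rw [Matrix.reindex_apply]
    ext x y
    obtain ⟨x, rfl⟩ := (splitBlocks n (show s + 1 + p = m + 1 by omega)).surjective x
    obtain ⟨y, rfl⟩ := (splitBlocks n (show p + 1 + s = m + 1 by omega)).surjective y
    rw [Matrix.submatrix_apply, Equiv.symm_apply_apply, Equiv.symm_apply_apply]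
    rcases x with ⟨i, a⟩ | ⟨i, a⟩ <;> rcases y with ⟨j, b⟩ | ⟨j, b⟩ <;>
      simp only [splitBlocks_inl, splitBlocks_inr, mul_blockPerm, blockTranspose_blockPerm_mul]
    · rfl
    · rw [h.fiedlerPencil_wingCol hq ⟨i, hlt i⟩ j j.2 a b _ _ rfl rfl]
      rfl
    · rw [h.fiedlerPencil_wingRow hq ⟨j, hlt' j⟩ i i.2 a b _ _ rfl rfl]
      rfl
    -- The zero block: the wing columns are known in all rows, and row place `s + 1 + i` lies beyond
    -- both nonzero places `j` and `j + 1`, as `j < s`.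
    · rw [h.fiedlerPencil_wingCol hq ⟨s + 1 + i, by omega⟩ j j.2 a b _ _ rfl rfl]
      simp only [Matrix.fromBlocks_apply₂₂, Matrix.zero_apply]
      rw [if_neg (by omega), if_neg (by omega), zero_mul]
  · intro u hu
    rw [← h.antidiagonal u (by omega), antidiagonalSum]
    simp only [Finset.sum_range]
    congr 1
    · refine Finset.sum_congr rfl fun i _ => Finset.sum_congr rfl fun j _ => ?_
      refine if_congr (by omega) ?_ rfl
      ext a b
      exact (fiedlerPencil_coeff P hq _ _ a b).2.1
    · refine Finset.sum_congr rfl fun i _ => Finset.sum_congr rfl fun j _ => ?_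
      refine if_congr (by omega) ?_ rfl
      ext a b
      exact (fiedlerPencil_coeff P hq _ _ a b).2.2
  · have key : ∀ (c : Fin (m + 1)) (t : ℕ), t < s → r (p + 1 + t) = c →
        blockCol (blockTranspose (blockPerm F[X] n L) * fiedlerPencil (m + 1) P q) c =
          wingColForm F (m + 1) n t := by
      intro c t ht hc
      ext ⟨i, a⟩ ⟨j, b⟩
      rw [blockCol, Matrix.submatrix_apply, id, blockTranspose_blockPerm_mul,
        h.fiedlerPencil_wingCol hq i t ht a b _ _ rfl hc.symm]
      by_cases h1 : (i : ℕ) = t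
      · simp [wingColForm, unitCol, h1]
      · by_cases h2 : (i : ℕ) = t + 1 <;> simp [wingColForm, unitCol, h1, h2]
    ext K
    constructor
    · rintro ⟨c, hc, rfl⟩
      rw [hR, h.mem_wingCols] at hc
      obtain ⟨t, ht, hc⟩ := hc
      exact ⟨t, ht, key c t ht hc⟩
    · rintro ⟨t, ht, rfl⟩
      refine ⟨R ⟨p + 1 + t, by omega⟩, ?_, key _ t ht rfl⟩
      rw [hR, h.mem_wingCols]
      exact ⟨t, ht, rfl⟩
  · have key : ∀ (c : Fin (m + 1)) (t : ℕ), t < p → l (s + 1 + t) = c →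
        blockRow (fiedlerPencil (m + 1) P q * blockPerm F[X] n R) c =
          wingRowForm F (m + 1) n t := by
      intro c t ht hc
      ext ⟨i, a⟩ ⟨j, b⟩
      rw [blockRow, Matrix.submatrix_apply, id, mul_blockPerm,
        h.fiedlerPencil_wingRow hq j t ht a b _ _ hc.symm rfl]
      by_cases h1 : (j : ℕ) = t
      · simp [wingRowForm, unitCol, h1]
      · by_cases h2 : (j : ℕ) = t + 1 <;> simp [wingRowForm, unitCol, h1, h2]
    ext K
    constructor
    · rintro ⟨c, hc, rfl⟩
      rw [hL, h.mem_wingRows] at hc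
      obtain ⟨t, ht, hc⟩ := hc
      exact ⟨t, ht, key c t ht hc⟩
    · rintro ⟨t, ht, rfl⟩
      refine ⟨L ⟨s + 1 + t, by omega⟩, ?_, key _ t ht rfl⟩
      rw [hL, h.mem_wingRows]
      exact ⟨t, ht, rfl⟩
  · ext a b : 2
    simp only [block, Matrix.of_apply]
    rw [fiedlerPencil_apply P hq]
    have e1 : ((L ⟨0, hk⟩ : Fin (m + 1)) : ℕ) = 0 := h.row_zero
    have e2 : ((R ⟨0, hk⟩ : Fin (m + 1)) : ℕ) = 0 := h.col_zero
    simp only [Fin.val_zero, e1, e2, h.entry_zero]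
    simp
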